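/- For a domain $A\supset\mathbb{Q}$ with fraction field $K(A)$, call an ideal $I\subset A$ central if for all $a\in A$ and all $b\in\sum K(A)^2$ (finite sums of squares), $a^2+b\in I$ implies $a\in I$. Let $\mathrm{Rad}^C(A)$ be the intersection of the ideals of $A$ that are both maximal and central (so $\mathrm{Rad}^C(A)=A$ if there are none; for the zero ring put $\mathrm{Rad}^C(0)=0$). Let $X$ be an integral scheme of finite type over $\mathbb{R}$, let $Y$ be an integral scheme, and let $\pi:Y\to X$ be a finite morphism. The central gluing $(\mathcal{O}_X)^{s_c}_Y$ is the sheaf of $\mathcal{O}_X$-subalgebras of $\pi_*\mathcal{O}_Y$ whose sections over an open subset $U\subset X$ are the $f\in\Gamma(U,\pi_*\mathcal{O}_Y)$ such that for every $x\in U$ the germ $f_x$ lies in $\mathcal{O}_{X,x}+\mathrm{Rad}^C\big((\pi_*\mathcal{O}_Y)_x\big)$, where $\mathcal{O}_{X,x}$ stands for its image in $(\pi_*\mathcal{O}_Y)_x$. **Theorem.** $(\mathcal{O}_X)^{s_c}_Y$ is a coherent sheaf of $\mathcal{O}_X$-modules on $X$. -/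

import Mathlib

open CategoryTheory AlgebraicGeometry TopologicalSpace

universe u

noncomputable section

namespace CentralGluing

section Algebra

/-- An ideal `I` of a domain `A` with fraction field `K` is *central* if for every `a` in `A` and
every sum of squares `b` in `K` such that `a ^ 2 + b` lies in `I`, the element `a` lies in `I`. -/
def IsCentral {A : Type u} [CommRing A] (I : Ideal A) : Prop :=
  ∀ (a : A) (b : FractionRing A), IsSumSq b →
    (∃ c ∈ I, algebraMap A (FractionRing A) c = algebraMap A (FractionRing A) a ^ 2 + b) → a ∈ I

/-- The *central Jacobson radical* of `A`: the intersection of the maximal central ideals of `A`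
(so it is all of `A` if there are none). -/
def centralRadical (A : Type u) [CommRing A] : Ideal A :=
  sInf {m : Ideal A | m.IsMaximal ∧ IsCentral m}

/-- The subring `φ(A) + J` of `B`, for a ring homomorphism `φ : A → B` and an ideal `J` of `B`. -/
def rangeAdd {A B : Type u} [CommRing A] [CommRing B] (φ : A →+* B) (J : Ideal B) : Subring B where
  carrier := {b | ∃ a : A, ∃ j ∈ J, b = φ a + j}
  mul_mem' := by
    rintro _ _ ⟨a, j, hj, rfl⟩ ⟨a', j', hj', rfl⟩
    refine ⟨a * a', φ a * j' + j * (φ a' + j'),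
      J.add_mem (J.mul_mem_left _ hj') (J.mul_mem_right _ hj), ?_⟩
    rw [map_mul]; ring
  one_mem' := ⟨1, 0, J.zero_mem, by simp⟩
  add_mem' := by
    rintro _ _ ⟨a, j, hj, rfl⟩ ⟨a', j', hj', rfl⟩
    refine ⟨a + a', j + j', J.add_mem hj hj', ?_⟩
    rw [map_add]; ring
  zero_mem' := ⟨0, 0, J.zero_mem, by simp⟩
  neg_mem' := by
    rintro _ ⟨a, j, hj, rfl⟩
    refine ⟨-a, -j, J.neg_mem hj, ?_⟩
    rw [map_neg]; ring

end Algebra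

section Scheme

variable {X Y : Scheme.{u}} (π : Y ⟶ X)

/-- The sheaf of rings `π_* 𝒪_Y` on `X`, as a presheaf. -/
abbrev directImage : TopCat.Presheaf CommRingCat.{u} X :=
  (TopCat.Presheaf.pushforward CommRingCat.{u} π.base).obj Y.presheaf

/-- The homomorphism of stalks `𝒪_{X,x} → (π_* 𝒪_Y)_x`. -/
def stalkHom (x : X) : X.presheaf.stalk x →+* (directImage π).stalk x :=
  ((TopCat.Presheaf.stalkFunctor CommRingCat.{u} x).map π.c).hom

/-- The subring `𝒪_{X,x} + Rad^C((π_* 𝒪_Y)_x)` of the stalk `(π_* 𝒪_Y)_x`. -/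
def stalkGluing (x : X) : Subring ((directImage π).stalk x) :=
  rangeAdd (stalkHom π x) (centralRadical ((directImage π).stalk x))

/-- The `Γ(X, U)`-algebra structure on `Γ(U, π_* 𝒪_Y) = Γ(Y, π⁻¹ U)`. -/
@[reducible]
def sectionsAlgebra (U : X.Opens) : Algebra Γ(X, U) Γ(Y, π ⁻¹ᵁ U) :=
  (π.app U).hom.toAlgebra

attribute [local instance] sectionsAlgebra

/-- The sections over `U` of the central gluing: the `f` in `Γ(U, π_* 𝒪_Y)` whose germ at each
point `x` of `U` lies in `𝒪_{X,x} + Rad^C((π_* 𝒪_Y)_x)`. They form a `Γ(X, U)`-subalgebra. -/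
def gluingSections (U : X.Opens) : Subalgebra Γ(X, U) Γ(Y, π ⁻¹ᵁ U) where
  carrier := {f | ∀ (x : X) (hx : x ∈ U), (directImage π).germ U x hx f ∈ stalkGluing π x}
  mul_mem' ha hb x hx := by
    have := (stalkGluing π x).mul_mem (ha x hx) (hb x hx)
    rwa [← map_mul] at this
  add_mem' ha hb x hx := by
    have := (stalkGluing π x).add_mem (ha x hx) (hb x hx)
    rwa [← map_add] at this
  algebraMap_mem' r x hx :=
    ⟨X.presheaf.germ U x hx r, 0, Ideal.zero_mem _, by
      rw [add_zero]
      exact (TopCat.Presheaf.stalkFunctor_map_germ_apply' U x hx π.c r).symm⟩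

/-- The `𝒪_X`-module `π_* 𝒪_Y`. -/
abbrev directImageModule : X.Modules :=
  (Scheme.Modules.pushforward π).obj (SheafOfModules.unit Y.ringCatSheaf)

/-- The central gluing as a subpresheaf of `𝒪_X`-modules of `π_* 𝒪_Y`. -/
def gluingSubmodule : PresheafOfModules.Submodule (directImageModule π).val where
  obj U := Subalgebra.toSubmodule (gluingSections π U.unop)
  map {U V} i f hf x hx := by
    have h : (directImage π).germ U.unop x (i.unop.le hx) f ∈ stalkGluing π x :=
      hf x (i.unop.le hx)
    have e := TopCat.Presheaf.germ_res_apply (directImage π) i.unop x hx f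
    exact e.symm ▸ h

lemma isSheaf_gluingSubmodule :
    TopCat.Presheaf.IsSheaf (gluingSubmodule π).toPresheafOfModules.presheaf := by
  rw [TopCat.Presheaf.isSheaf_iff_isSheaf_comp (forget AddCommGrpCat)]
  apply TopCat.Presheaf.isSheaf_of_isSheafUniqueGluing_types
  intro ι U s hs
  obtain ⟨f, hf, huniq⟩ := TopCat.Sheaf.existsUnique_gluing
    (F := (⟨_, (directImageModule π).isSheaf⟩ : TopCat.Sheaf Ab X)) U (fun i ↦ (s i).1)
    (fun i j ↦ congrArg Subtype.val (hs i j))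
  refine ⟨⟨f, fun x hx ↦ ?_⟩, fun i ↦ Subtype.ext (hf i), fun g hg ↦
    Subtype.ext (huniq _ fun i ↦ congrArg Subtype.val (hg i))⟩
  obtain ⟨i, hi⟩ := Opens.mem_iSup.mp hx
  have h : (directImage π).germ (U i) x hi (s i).1 ∈ stalkGluing π x := (s i).2 x hi
  have hi' : (directImage π).map (Opens.leSupr U i).op f = (s i).1 := hf i
  rw [← hi'] at h
  have e := TopCat.Presheaf.germ_res_apply (directImage π) (Opens.leSupr U i) x hi f
  exact e ▸ h

/-- The central gluing `(𝒪_X)^{s_c}_Y` of `π_* 𝒪_Y` over `𝒪_X`, as a sheaf of `𝒪_X`-modules. Its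
sections over `U` are those of the `Γ(X, U)`-subalgebra `gluingSections π U`. -/
def centralGluing : X.Modules where
  val := (gluingSubmodule π).toPresheafOfModules
  isSheaf := isSheaf_gluingSubmodule π

/-- A sheaf of modules `M` on `X` is *coherent* if `X` is covered by affine open subsets
`U = Spec A` on which `M` is isomorphic to the sheaf `N^~` of a finitely generated `A`-module `N`.
(On a locally Noetherian scheme this is the usual notion.) -/
def IsCoherent (M : X.Modules) : Prop :=
  ∀ x : X, ∃ (U : X.Opens) (hU : IsAffineOpen U) (N : ModuleCat.{u} Γ(X, U)),
    x ∈ U ∧ Module.Finite Γ(X, U) N ∧ Nonempty (M.restrict hU.fromSpec ≅ tilde N)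

end Scheme

end CentralGluing

end

noncomputable section

namespace CentralGluing

/-! ### Sections of the central gluing over affine opens -/

section

variable {X Y : Scheme.{u}} (π : Y ⟶ X)

/-! Since `π` is finite, every maximal ideal of `(π_* 𝒪_Y)_x` lies over the maximal ideal `m_x` of
`𝒪_{X,x}`, so `m_x` maps into the central radical (`stalkHom_mem_centralRadical`). Hence if `t` over
an affine `U` satisfies the gluing condition on `D(r)`, then `r t` satisfies it on all of `U`: off
`D(r)` the germ of `r` lies in `m_x` (`app_mul_mem_gluingSections`). Together with the localization
property of `π_* 𝒪_Y`, this makes the sections over `D(r)` the localization at `r` of those over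
`U`, which is quasi-coherence. Finiteness is inherited from `π_* 𝒪_Y`, as `X` is locally Noetherian.
-/

lemma stalkHom_germ (U : X.Opens) (x : X) (hx : x ∈ U) (r : Γ(X, U)) :
    stalkHom π x (X.presheaf.germ U x hx r) = (directImage π).germ U x hx (π.app U r) :=
  TopCat.Presheaf.stalkFunctor_map_germ_apply' U x hx π.c r

/-- A germ is represented over an affine neighbourhood, where finiteness gives a monic equation; its
germ at `x` is the required one. -/
lemma stalkHom_isIntegral [IsFinite π] (x : X) : (stalkHom π x).IsIntegral := by
  intro b
  obtain ⟨U, hx, s, rfl⟩ := (directImage π).exists_germ_eq b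
  obtain ⟨_, ⟨W, hW, rfl⟩, hxW, hWU⟩ :=
    X.isBasis_affineOpens.exists_subset_of_mem_open hx U.isOpen
  have hWU : W ≤ U := hWU
  rw [← TopCat.Presheaf.germ_res_apply (directImage π) (homOfLE hWU) x hxW s]
  set t : Γ(Y, π ⁻¹ᵁ W) := (directImage π).map (homOfLE hWU).op s
  obtain ⟨q, hq, hqt⟩ := (π.finite_app W hW).to_isIntegral t
  refine ⟨q.map (X.presheaf.germ W x hxW).hom, hq.map _, ?_⟩
  have h : (stalkHom π x).comp (X.presheaf.germ W x hxW).hom =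
      ((directImage π).germ W x hxW).hom.comp (π.app W).hom :=
    RingHom.ext fun r ↦ stalkHom_germ π W x hxW r
  rw [Polynomial.eval₂_map, h]
  have := congrArg ((directImage π).germ W x hxW).hom hqt
  rw [Polynomial.hom_eval₂, map_zero] at this
  exact this

lemma stalkHom_mem_centralRadical [IsFinite π] (x : X) {r : X.presheaf.stalk x}
    (hr : r ∈ IsLocalRing.maximalIdeal (X.presheaf.stalk x)) :
    stalkHom π x r ∈ centralRadical ((directImage π).stalk x) := by
  refine Ideal.mem_sInf.mpr fun {m} ⟨hm, _⟩ ↦ ?_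
  have := Ideal.isMaximal_comap_of_isIntegral_of_isMaximal' _ (stalkHom_isIntegral π x) m
  rw [← IsLocalRing.eq_maximalIdeal this] at hr
  exact hr

variable {π}

/-- A section of `π_* 𝒪_Y` over `U` which lies in the gluing over `D(r)` lies in the gluing over `U`
after multiplication by `r`. -/
lemma app_mul_mem_gluingSections [IsFinite π] {U : X.Opens} (r : Γ(X, U)) (t : Γ(Y, π ⁻¹ᵁ U))
    (ht : (directImage π).map (homOfLE (X.basicOpen_le r)).op t ∈ gluingSections π (X.basicOpen r)) :
    π.app U r * t ∈ gluingSections π U := by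
  intro x hx
  have key : (directImage π).germ U x hx (π.app U r * t) =
      stalkHom π x (X.presheaf.germ U x hx r) * (directImage π).germ U x hx t := by
    rw [stalkHom_germ]; exact map_mul _ _ _
  rw [key]
  by_cases hxr : x ∈ X.basicOpen r
  · refine (stalkGluing π x).mul_mem ⟨_, 0, Ideal.zero_mem _, (add_zero _).symm⟩ ?_
    have := ht x hxr
    rwa [TopCat.Presheaf.germ_res_apply] at this
  -- Off `D(r)` the germ of `r` is a nonunit, so the product lies in the central radical whatever
  -- `t` is.
  · rw [X.mem_basicOpen r x hx, ← mem_nonunits_iff] at hxr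
    exact ⟨0, _, Ideal.mul_mem_right _ _ (stalkHom_mem_centralRadical π x hxr),
      by rw [map_zero, zero_add]⟩

variable (π) in
/-- The inclusion of the sections of the central gluing into those of `π_* 𝒪_Y`. -/
def inclusion (W : X.Opens) : Γ(centralGluing π, W) →+ Γ(Y, π ⁻¹ᵁ W) where
  toFun s := (show gluingSections π W from s).1
  map_zero' := rfl
  map_add' _ _ := rfl

lemma inclusion_injective (W : X.Opens) : Function.Injective (inclusion π W) :=
  Subtype.val_injective

lemma inclusion_smul {W : X.Opens} (r : Γ(X, W)) (s : Γ(centralGluing π, W)) :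
    inclusion π W (r • s) = π.app W r * inclusion π W s :=
  rfl

lemma inclusion_map {V W : X.Opens} (i : V ⟶ W) (s : Γ(centralGluing π, W)) :
    inclusion π V ((centralGluing π).presheaf.map i.op s) =
      (directImage π).map i.op (inclusion π W s) :=
  rfl

lemma inclusion_mem {W : X.Opens} (s : Γ(centralGluing π, W)) :
    inclusion π W s ∈ gluingSections π W :=
  Subtype.property (p := (· ∈ gluingSections π W)) s

lemma exists_inclusion_eq {W : X.Opens} {t : Γ(Y, π ⁻¹ᵁ W)} (ht : t ∈ gluingSections π W) :
    ∃ s : Γ(centralGluing π, W), inclusion π W s = t :=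
  ⟨(⟨t, ht⟩ : gluingSections π W), rfl⟩

variable [IsFinite π]

lemma isLocalization_away_preimage_basicOpen {U : X.Opens} (hU : IsAffineOpen U) (r : Γ(X, U)) :
    letI := (Y.presheaf.map ((Opens.map π.base).map (homOfLE (X.basicOpen_le r))).op).hom.toAlgebra
    IsLocalization.Away (π.app U r) Γ(Y, π ⁻¹ᵁ X.basicOpen r) :=
  (hU.preimage π).isLocalization_of_eq_basicOpen (π.app U r) _ (Scheme.preimage_basicOpen π r)

lemma exists_map_eq_pow_smul {U : X.Opens} (hU : IsAffineOpen U) (r : Γ(X, U))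
    (s : Γ(centralGluing π, X.basicOpen r)) :
    ∃ (n : ℕ) (t : Γ(centralGluing π, U)),
      X.presheaf.map (homOfLE (X.basicOpen_le r)).op r ^ n • s =
        (centralGluing π).presheaf.map (homOfLE (X.basicOpen_le r)).op t := by
  let ρ : Γ(Y, π ⁻¹ᵁ U) →+* Γ(Y, π ⁻¹ᵁ X.basicOpen r) :=
    (Y.presheaf.map ((Opens.map π.base).map (homOfLE (X.basicOpen_le r))).op).hom
  let := ρ.toAlgebra
  have : IsLocalization.Away (π.app U r) Γ(Y, π ⁻¹ᵁ X.basicOpen r) :=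
    isLocalization_away_preimage_basicOpen hU r
  obtain ⟨n, b, hb⟩ := IsLocalization.Away.surj (π.app U r) (inclusion π _ s)
  replace hb : inclusion π _ s * ρ (π.app U r) ^ n = ρ b := by rw [← map_pow] at hb ⊢; exact hb
  have hρ (a : Γ(X, U)) : π.app _ (X.presheaf.map (homOfLE (X.basicOpen_le r)).op a) =
      ρ (π.app U a) := ConcreteCategory.congr_hom (π.c.naturality _) a
  have hmem : ρ b ∈ gluingSections π (X.basicOpen r) := by
    rw [← hb, mul_comm, ← hρ, ← map_pow, ← inclusion_smul]
    exact inclusion_mem _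
  -- `b` may violate the gluing condition off `D(r)`; one more factor `r` repairs this, whence the
  -- exponent `n + 1`.
  obtain ⟨t, ht⟩ := exists_inclusion_eq (app_mul_mem_gluingSections r b hmem)
  refine ⟨n + 1, t, inclusion_injective _ ?_⟩
  rw [inclusion_map, ht, inclusion_smul, map_pow, hρ]
  refine Eq.trans ?_ (map_mul ρ (π.app U r) b).symm
  rw [← hb]
  ring

lemma exists_pow_smul_eq_zero {U : X.Opens} (hU : IsAffineOpen U) (r : Γ(X, U))
    (s : Γ(centralGluing π, U))
    (hs : (centralGluing π).presheaf.map (homOfLE (X.basicOpen_le r)).op s = 0) :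
    ∃ n : ℕ, r ^ n • s = 0 := by
  let ρ : Γ(Y, π ⁻¹ᵁ U) →+* Γ(Y, π ⁻¹ᵁ X.basicOpen r) :=
    (Y.presheaf.map ((Opens.map π.base).map (homOfLE (X.basicOpen_le r))).op).hom
  let := ρ.toAlgebra
  have : IsLocalization.Away (π.app U r) Γ(Y, π ⁻¹ᵁ X.basicOpen r) :=
    isLocalization_away_preimage_basicOpen hU r
  have h : ρ (inclusion π _ s) = ρ 0 := by
    rw [map_zero, ← map_zero (inclusion π (X.basicOpen r)), ← hs]
    rfl
  obtain ⟨n, hn⟩ := IsLocalization.Away.exists_of_eq (π.app U r) h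
  refine ⟨n, inclusion_injective _ ?_⟩
  rw [inclusion_smul, map_pow, hn, mul_zero, map_zero]

lemma finite_gluingSections {U : X.Opens} (hU : IsAffineOpen U) [IsNoetherianRing Γ(X, U)] :
    Module.Finite Γ(X, U) Γ(centralGluing π, U) := by
  let := sectionsAlgebra π U
  have : Module.Finite Γ(X, U) Γ(Y, π ⁻¹ᵁ U) := π.finite_app U hU
  exact Module.Finite.of_injective
    ({ inclusion π U with map_smul' := inclusion_smul } :
      Γ(centralGluing π, U) →ₗ[Γ(X, U)] Γ(Y, π ⁻¹ᵁ U)) (inclusion_injective U)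

instance : IsNoetherianRing (ULift.{u} ℝ) := isNoetherianRing_of_ringEquiv ℝ ULift.ringEquiv.symm

end

/-! ### From sections over an affine open to modules on its spectrum -/

section

variable {X : Scheme.{u}} {U : X.Opens} (hU : IsAffineOpen U) (M : X.Modules)

lemma fromSpec_image_le (V : (Spec Γ(X, U)).Opens) : hU.fromSpec ''ᵁ V ≤ U :=
  (hU.fromSpec.image_le_opensRange V).trans hU.opensRange_fromSpec.le

lemma restrict_fromSpec_smul {V : (Spec Γ(X, U)).Opens} (r : Γ(X, U))
    (s : Γ(M.restrict hU.fromSpec, V)) :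
    (M.restrictAppIso hU.fromSpec V).hom (r • s) =
      X.presheaf.map (homOfLE (fromSpec_image_le hU V)).op r •
        (M.restrictAppIso hU.fromSpec V).hom s := by
  rw [Scheme.Modules.smul_Spec_def, Scheme.Modules.smul_restrictAppIso_hom_apply]
  congr 1
  have h := hU.fromSpec.appLE_appIso_inv (V := V) (U := U) (by
    rw [hU.fromSpec_preimage_self]; exact le_top)
  rw [Scheme.Hom.appLE, hU.fromSpec_app_self, Category.assoc, Category.assoc,
    ← Functor.map_comp_assoc, ← op_comp] at h
  exact ConcreteCategory.congr_hom h r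

/-- `h₁` and `h₂` are surjectivity and injectivity up to powers of `r`. Invertibility of `r` on
`D(r)` holds for any module. -/
lemma isLocalizing_restrict_fromSpec
    (h₁ : ∀ (r : Γ(X, U)) (s : Γ(M, X.basicOpen r)), ∃ (n : ℕ) (t : Γ(M, U)),
      X.presheaf.map (homOfLE (X.basicOpen_le r)).op r ^ n • s =
        M.presheaf.map (homOfLE (X.basicOpen_le r)).op t)
    (h₂ : ∀ (r : Γ(X, U)) (s : Γ(M, U)),
      M.presheaf.map (homOfLE (X.basicOpen_le r)).op s = 0 → ∃ n : ℕ, r ^ n • s = 0) :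
    IsLocalizing (modulesSpecToSheaf.obj (M.restrict hU.fromSpec)) := by
  intro r
  -- The images under `hU.fromSpec` equal `U` and `D(r)` only propositionally; with variable opens
  -- the equalities can be substituted.
  have h₁' {V W : X.Opens} (hW : W = U) (hV : V = X.basicOpen r) (i : V ⟶ W) (j : V ⟶ U)
      (s : Γ(M, V)) : ∃ (n : ℕ) (t : Γ(M, W)),
        X.presheaf.map j.op r ^ n • s = M.presheaf.map i.op t := by
    subst hW hV
    exact h₁ r s
  have h₂' {V W : X.Opens} (hW : W = U) (hV : V = X.basicOpen r) (i : V ⟶ W) (j : W ⟶ U)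
      (s : Γ(M, W)) (hs : M.presheaf.map i.op s = 0) :
      ∃ n : ℕ, X.presheaf.map j.op r ^ n • s = 0 := by
    subst hW hV
    obtain ⟨n, hn⟩ := h₂ r s hs
    refine ⟨n, ?_⟩
    rwa [show j = 𝟙 _ from Subsingleton.elim _ _, op_id, X.presheaf.map_id]
  have htop : hU.fromSpec ''ᵁ ⊤ = U := by
    rw [Scheme.Hom.image_top_eq_opensRange, hU.opensRange_fromSpec]
  refine IsLocalizedModule.Away.mk_of_addCommGroup
    (Scheme.Modules.isUnit_algebraMap_end_of_le_basicOpen r le_rfl) (fun s ↦ ?_) (fun s hs ↦ ?_)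
  · obtain ⟨n, t, ht⟩ := h₁' htop (hU.fromSpec_image_basicOpen r)
      (homOfLE (hU.fromSpec.image_mono le_top)) (homOfLE (fromSpec_image_le hU _)) s
    refine ⟨n, t, Eq.trans ?_ ht⟩
    rw [← map_pow]
    exact restrict_fromSpec_smul hU M (r ^ n) s
  · obtain ⟨n, hn⟩ := h₂' htop (hU.fromSpec_image_basicOpen r)
      (homOfLE (hU.fromSpec.image_mono le_top)) (homOfLE (fromSpec_image_le hU _)) s hs
    refine ⟨n, Eq.trans ?_ hn⟩
    rw [← map_pow]
    exact restrict_fromSpec_smul hU M (r ^ n) s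

lemma finite_restrict_fromSpec [IsNoetherianRing Γ(X, U)] [Module.Finite Γ(X, U) Γ(M, U)] :
    Module.Finite Γ(X, U)
      ((modulesSpecToSheaf.obj (M.restrict hU.fromSpec)).presheaf.obj (.op ⊤)) := by
  have htop : hU.fromSpec ''ᵁ ⊤ = U := by
    rw [Scheme.Hom.image_top_eq_opensRange, hU.opensRange_fromSpec]
  let φ : Γ(M, hU.fromSpec ''ᵁ ⊤) →+ Γ(M, U) := (M.presheaf.map (eqToHom htop.symm).op).hom
  have hφ : Function.Injective φ :=
    (ConcreteCategory.bijective_of_isIso (M.presheaf.map (eqToHom htop.symm).op)).1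
  refine Module.Finite.of_injective (M := Γ(M.restrict hU.fromSpec, ⊤)) (N := Γ(M, U))
    ({ φ with map_smul' := fun r s ↦ ?_ } :
      Γ(M.restrict hU.fromSpec, ⊤) →ₗ[Γ(X, U)] Γ(M, U)) hφ
  refine (congrArg φ (restrict_fromSpec_smul hU M r s)).trans ?_
  refine (M.map_smul (eqToHom htop.symm) _ _).trans ?_
  rw [← X.presheaf.map_comp_apply, ← op_comp, Subsingleton.elim (_ ≫ _) (𝟙 U), op_id,
    X.presheaf.map_id]
  rfl

end

end CentralGluing

end

open CentralGluing

theorem theorem8p11 {X Y : Scheme.{u}} [AlgebraicGeometry.IsIntegral X]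
    [AlgebraicGeometry.IsIntegral Y]
    (p : X ⟶ Spec (CommRingCat.of (ULift.{u} ℝ))) [LocallyOfFiniteType p] [QuasiCompact p]
    (π : Y ⟶ X) [AlgebraicGeometry.IsFinite π] :
    CentralGluing.IsCoherent (CentralGluing.centralGluing π) := by
  intro x
  have := LocallyOfFiniteType.isLocallyNoetherian p
  obtain ⟨_, ⟨U, hU, rfl⟩, hxU, -⟩ :=
    X.isBasis_affineOpens.exists_subset_of_mem_open (Set.mem_univ x) isOpen_univ
  have : IsNoetherianRing Γ(X, U) := IsLocallyNoetherian.component_noetherian ⟨U, hU⟩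
  replace hU : IsAffineOpen U := hU
  have := finite_gluingSections (π := π) hU
  let M := (centralGluing π).restrict hU.fromSpec
  have : IsIso M.fromTildeΓ := (isIso_fromTildeΓ_iff_isLocalizing M).mpr
    (isLocalizing_restrict_fromSpec hU _ (exists_map_eq_pow_smul hU)
      (exists_pow_smul_eq_zero hU))
  exact ⟨U, hU, _, hxU, finite_restrict_fromSpec hU _, ⟨(asIso M.fromTildeΓ).symm⟩⟩
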